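/- **Definitions.** A (planar) *h-set* $N$ (with one unstable and one stable direction) is given by a homeomorphism $c_N:\mathbb{R}^2\to\mathbb{R}^2$. Its support is $|N|=c_N([-1,1]\times[-1,1])$, its left and right edges are $N^{le}=c_N(\{-1\}\times[-1,1])$ and $N^{re}=c_N(\{1\}\times[-1,1])$, and its left and right sides are $N^{l}=c_N((-\infty,-1]\times\mathbb{R})$ and $N^{r}=c_N([1,\infty)\times\mathbb{R})$. For example, if $u,s\in\mathbb{R}^2$ are linearly independent, the parallelogram h-set $t(c,u,s)$ has $c_N(x,y)=c+xu+ys$. Put $Q=[-1,1]^2$, $Q^-=\{-1,1\}\times[-1,1]$, $Q^+=[-1,1]\times\{-1,1\}$. For h-sets $N,M$, a continuous map $f:\mathbb{R}^2\to\mathbb{R}^2$ and $w\in\mathbb{Z}$, we say that $N$ *$f$-covers $M$ with degree $w$* if there are a continuous homotopy $h:[0,1]\times Q\to\mathbb{R}^2$ and a continuous map $A:\mathbb{R}\to\mathbb{R}$ such that - $h_0=c_M^{-1}\circ f\circ c_N$ on $Q$, $\;h([0,1]\times Q^-)\cap Q=\emptyset$, $\;h([0,1]\times Q)\cap Q^+=\emptyset$;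 - $h_1(p,q)=(A(p),0)$ for $(p,q)\in Q$, $\;A(\pm1)\notin[-1,1]$, and the Brouwer degree $\deg(A,(-1,1),0)=\tfrac12\bigl(\operatorname{sgn}A(1)-\operatorname{sgn}A(-1)\bigr)$ equals $w$. A *fuzzy h-set* $\widetilde N$ is a collection of h-sets, for example $t(W,u,s)=\{t(w,u,s): w\in W\}$ with $W\subset\mathbb{R}^2$. With $\langle Z\rangle$ denoting the convex hull of $Z$, put $$|\widetilde N|=\Big\langle\bigcup_{M\in\widetilde N}|M|\Big\rangle,\quad \widetilde N^{le}=\Big\langle\bigcup_{M\in\widetilde N}M^{le}\Big\rangle,\quad \widetilde N^{re}=\Big\langle\bigcup_{M\in\widetilde N}M^{re}\Big\rangle,$$ $$\widetilde N^{l}=\bigcap_{M\in\widetilde N}M^{l},\quad \widetilde N^{r}=\bigcap_{M\in\widetilde N}M^{r},\quad \operatorname{strip}(\widetilde N)=\bigcap_{M\in\widetilde N}\operatorname{int}\bigl(M^l\cup|M|\cup M^r\bigr).$$ We say that $\widetilde N_1$ *$f$-covers* $\widetilde N_2$ if there is a nonzero integer $w$ such that every $M_1\in\widetilde N_1$ $f$-covers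 every $M_2\in\widetilde N_2$ with degree $w$. **Lemma.** Let $f:\mathbb{R}^2\to\mathbb{R}^2$ be a continuous map and let $\widetilde N_1$, $\widetilde N_2$ be fuzzy h-sets. Assume that $f$ is injective on $|\widetilde N_1|$ and that - **(af)** $f(|\widetilde N_1|)\subset\operatorname{strip}(\widetilde N_2)$; - **(bf)** either $f(\widetilde N_1^{le})\subset\operatorname{int}(\widetilde N_2^{l})$ and $f(\widetilde N_1^{re})\subset\operatorname{int}(\widetilde N_2^{r})$, or $f(\widetilde N_1^{le})\subset\operatorname{int}(\widetilde N_2^{r})$ and $f(\widetilde N_1^{re})\subset\operatorname{int}(\widetilde N_2^{l})$. Then $\widetilde N_1$ $f$-covers $\widetilde N_2$. -/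

import Mathlib

/-! Planar h-sets with one unstable and one stable direction, covering relations between them,
and fuzzy h-sets. -/

/-- The plane. -/
abbrev Plane : Type := ℝ × ℝ

/-- The model square `[-1,1] × [-1,1]`; the first coordinate is the unstable one. -/
def modelSquare : Set Plane := Set.Icc (-1) 1 ×ˢ Set.Icc (-1) 1

/-- The exit set of the model square: its two vertical edges `{-1,1} × [-1,1]`. -/
def modelExit : Set Plane := {-1, 1} ×ˢ Set.Icc (-1) 1

/-- The entry set of the model square: its two horizontal edges `[-1,1] × {-1,1}`. -/
def modelEntry : Set Plane := Set.Icc (-1) 1 ×ˢ {-1, 1}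

/-- A planar h-set with `u = s = 1`: a homeomorphism `chart` of the plane (from coordinates to
points); the support is the image of the model square. -/
structure PlanarHSet where
  /-- the coordinate map, from the model coordinates to the plane -/
  chart : Plane ≃ₜ Plane

namespace PlanarHSet

/-- The support `|N|`. -/
def support (N : PlanarHSet) : Set Plane := N.chart '' modelSquare

/-- The left edge of `N`. -/
def leftEdge (N : PlanarHSet) : Set Plane := N.chart '' ({-1} ×ˢ Set.Icc (-1) 1)

/-- The right edge of `N`. -/
def rightEdge (N : PlanarHSet) : Set Plane := N.chart '' ({1} ×ˢ Set.Icc (-1) 1)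

/-- The left side of `N`. -/
def leftSide (N : PlanarHSet) : Set Plane := N.chart '' (Set.Iic (-1) ×ˢ Set.univ)

/-- The right side of `N`. -/
def rightSide (N : PlanarHSet) : Set Plane := N.chart '' (Set.Ici 1 ×ˢ Set.univ)

/-- The parallelogram h-set `t(c,u,s)` with centre `c` and linearly independent half-axes `u`
(unstable) and `s` (stable); its chart is `(x, y) ↦ c + x • u + y • s`. -/
noncomputable def t (c u s : Plane) (hus : u.1 * s.2 - u.2 * s.1 ≠ 0) : PlanarHSet where
  chart :=
    { toFun := fun z => c + z.1 • u + z.2 • s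
      invFun := fun p =>
        (((p.1 - c.1) * s.2 - (p.2 - c.2) * s.1) / (u.1 * s.2 - u.2 * s.1),
          (u.1 * (p.2 - c.2) - u.2 * (p.1 - c.1)) / (u.1 * s.2 - u.2 * s.1))
      left_inv := by
        intro z
        ext
        · simp only [Prod.fst_add, Prod.snd_add, Prod.smul_fst, Prod.smul_snd, smul_eq_mul]
          rw [div_eq_iff hus]; ring
        · simp only [Prod.fst_add, Prod.snd_add, Prod.smul_fst, Prod.smul_snd, smul_eq_mul]
          rw [div_eq_iff hus]; ring
      right_inv := by
        intro p
        ext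
        · simp only [Prod.fst_add, Prod.smul_fst, smul_eq_mul]
          rw [add_assoc, div_mul_eq_mul_div, div_mul_eq_mul_div, ← add_div, ← eq_sub_iff_add_eq',
            div_eq_iff hus]
          ring
        · simp only [Prod.snd_add, Prod.smul_snd, smul_eq_mul]
          rw [add_assoc, div_mul_eq_mul_div, div_mul_eq_mul_div, ← add_div, ← eq_sub_iff_add_eq',
            div_eq_iff hus]
          ring
      continuous_toFun := by fun_prop
      continuous_invFun := by fun_prop }

end PlanarHSet

/-- The Brouwer degree `deg(A, (a,b), y)` in dimension one, for a continuous `A` with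
`A a ≠ y` and `A b ≠ y` (then both signs are `±1` and the division by two is exact). The facts
below are its normalization, additivity, excision and homotopy properties. -/
noncomputable def degreeOne (A : ℝ → ℝ) (a b y : ℝ) : ℤ :=
  ((SignType.sign (A b - y) : ℤ) - (SignType.sign (A a - y) : ℤ)) / 2

theorem degreeOne_id {a b y : ℝ} (ha : a < y) (hb : y < b) : degreeOne id a b y = 1 := by
  simp [degreeOne, sign_pos (sub_pos.2 hb), sign_neg (sub_neg.2 ha)]

theorem degreeOne_add {A : ℝ → ℝ} {a b c y : ℝ} (ha : A a ≠ y) (hb : A b ≠ y) (hc : A c ≠ y) :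
    degreeOne A a c y = degreeOne A a b y + degreeOne A b c y := by
  rcases lt_or_gt_of_ne ha with ha | ha <;> rcases lt_or_gt_of_ne hb with hb | hb <;>
    rcases lt_or_gt_of_ne hc with hc | hc <;>
    simp [degreeOne, sub_pos.2, sub_neg.2, ha, hb, hc, sign_pos, sign_neg]

theorem degreeOne_homotopy {H : ℝ → ℝ → ℝ} {a b y : ℝ}
    (hca : ContinuousOn (fun r => H r a) (Set.Icc 0 1))
    (hcb : ContinuousOn (fun r => H r b) (Set.Icc 0 1))
    (ha : ∀ r ∈ Set.Icc (0 : ℝ) 1, H r a ≠ y) (hb : ∀ r ∈ Set.Icc (0 : ℝ) 1, H r b ≠ y) :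
    degreeOne (H 0) a b y = degreeOne (H 1) a b y := by
  have key : ∀ e : ℝ, ContinuousOn (fun r => H r e) (Set.Icc 0 1) →
      (∀ r ∈ Set.Icc (0 : ℝ) 1, H r e ≠ y) →
      SignType.sign (H 0 e - y) = SignType.sign (H 1 e - y) := by
    intro e hc hne
    have h0 := hne 0 (by simp)
    have h1 := hne 1 (by simp)
    rcases lt_or_gt_of_ne h0 with h0 | h0 <;> rcases lt_or_gt_of_ne h1 with h1 | h1
    · rw [sign_neg (sub_neg.2 h0), sign_neg (sub_neg.2 h1)]
    · obtain ⟨r, hr, hry⟩ := intermediate_value_Icc zero_le_one hc ⟨h0.le, h1.le⟩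
      exact absurd hry (hne r hr)
    · obtain ⟨r, hr, hry⟩ := intermediate_value_Icc' zero_le_one hc ⟨h1.le, h0.le⟩
      exact absurd hry (hne r hr)
    · rw [sign_pos (sub_pos.2 h0), sign_pos (sub_pos.2 h1)]
  simp only [degreeOne, key a hca ha, key b hcb hb]

theorem degreeOne_eq_zero {A : ℝ → ℝ} {a b y : ℝ} (hab : a ≤ b)
    (hA : ContinuousOn A (Set.Icc a b)) (hne : ∀ x ∈ Set.Icc a b, A x ≠ y) :
    degreeOne A a b y = 0 := by
  have h0 := hne a (Set.left_mem_Icc.2 hab)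
  have h1 := hne b (Set.right_mem_Icc.2 hab)
  rcases lt_or_gt_of_ne h0 with h0 | h0 <;> rcases lt_or_gt_of_ne h1 with h1 | h1
  · simp [degreeOne, sign_neg (sub_neg.2 h0), sign_neg (sub_neg.2 h1)]
  · obtain ⟨r, hr, hry⟩ := intermediate_value_Icc hab hA ⟨h0.le, h1.le⟩
    exact absurd hry (hne r hr)
  · obtain ⟨r, hr, hry⟩ := intermediate_value_Icc' hab hA ⟨h1.le, h0.le⟩
    exact absurd hry (hne r hr)
  · simp [degreeOne, sign_pos (sub_pos.2 h0), sign_pos (sub_pos.2 h1)]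

/-- `N` `f`-covers `M` with degree `w`. -/
def PlanarHSet.CoversWith (N M : PlanarHSet) (f : Plane → Plane) (w : ℤ) : Prop :=
  ∃ h : ℝ → Plane → Plane,
    ContinuousOn (Function.uncurry h) (Set.Icc 0 1 ×ˢ modelSquare) ∧
    (∀ z ∈ modelSquare, h 0 z = M.chart.symm (f (N.chart z))) ∧
    (∀ r ∈ Set.Icc (0 : ℝ) 1, ∀ z ∈ modelExit, h r z ∉ modelSquare) ∧
    (∀ r ∈ Set.Icc (0 : ℝ) 1, ∀ z ∈ modelSquare, h r z ∉ modelEntry) ∧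
    ∃ A : ℝ → ℝ, Continuous A ∧
      (∀ z ∈ modelSquare, h 1 z = (A z.1, 0)) ∧
      A (-1) ∉ Set.Icc (-1 : ℝ) 1 ∧ A 1 ∉ Set.Icc (-1 : ℝ) 1 ∧
      degreeOne A (-1) 1 0 = w

/-- A fuzzy h-set is a collection of h-sets. -/
abbrev FuzzyHSet : Type := Set PlanarHSet

namespace FuzzyHSet

/-- The fuzzy h-set `t(W,u,s)` of all parallelograms `t(w,u,s)` with centre `w ∈ W`. -/
noncomputable def t (W : Set Plane) (u s : Plane) (hus : u.1 * s.2 - u.2 * s.1 ≠ 0) : FuzzyHSet :=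
  (fun w => PlanarHSet.t w u s hus) '' W

/-- The support: the convex hull of the union of the supports of the members. -/
def support (N : FuzzyHSet) : Set Plane := convexHull ℝ (⋃ M ∈ N, PlanarHSet.support M)

/-- The fuzzy left edge. -/
def leftEdge (N : FuzzyHSet) : Set Plane := convexHull ℝ (⋃ M ∈ N, PlanarHSet.leftEdge M)

/-- The fuzzy right edge. -/
def rightEdge (N : FuzzyHSet) : Set Plane := convexHull ℝ (⋃ M ∈ N, PlanarHSet.rightEdge M)

/-- The fuzzy left side. -/
def leftSide (N : FuzzyHSet) : Set Plane := ⋂ M ∈ N, PlanarHSet.leftSide M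

/-- The fuzzy right side. -/
def rightSide (N : FuzzyHSet) : Set Plane := ⋂ M ∈ N, PlanarHSet.rightSide M

/-- The allowed region for the image of an h-set covering `N`. -/
def strip (N : FuzzyHSet) : Set Plane :=
  ⋂ M ∈ N, interior (PlanarHSet.leftSide M ∪ PlanarHSet.support M ∪ PlanarHSet.rightSide M)

/-- `N₁` `f`-covers `N₂`: for some nonzero degree `w`, every member of `N₁` `f`-covers every
member of `N₂` with degree `w`. -/
def Covers (N₁ N₂ : FuzzyHSet) (f : Plane → Plane) : Prop :=
  ∃ w : ℤ, w ≠ 0 ∧ ∀ M₁ ∈ N₁, ∀ M₂ ∈ N₂, PlanarHSet.CoversWith M₁ M₂ f w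

end FuzzyHSet

/-! Covering reduces to a single pair of members, because convex hulls contain the pieces of each
member and the intersections defining sides and strip lie in those of each member. For one pair,
pass to model coordinates. By (af), an image point with first coordinate in `[-1,1]` has second
coordinate in `(-1,1)`; by (bf), the vertical edges go strictly beyond the lines `x = ±1`.
Flattening the image onto the horizontal axis and then deforming linearly to `A x = ±2x` respects
both conditions (`coversWith_of_model`). The sign, hence the degree `±1`, is fixed by the
alternative in (bf). -/

/-- A point interior to the left half-plane `x ≤ -1` has first coordinate less than `-1`. -/
theorem fst_lt_neg_one_of_mem_interior {z : Plane}
    (hz : z ∈ interior (Set.Iic (-1 : ℝ) ×ˢ (Set.univ : Set ℝ))) : z.1 < -1 := by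
  rw [interior_prod_eq, interior_Iic] at hz
  exact hz.1

/-- A point interior to the right half-plane `1 ≤ x` has first coordinate greater than `1`. -/
theorem one_lt_fst_of_mem_interior {z : Plane}
    (hz : z ∈ interior (Set.Ici (1 : ℝ) ×ˢ (Set.univ : Set ℝ))) : 1 < z.1 := by
  rw [interior_prod_eq, interior_Ici] at hz
  exact hz.1

/-- The interior of the union of the two outer half-planes and the model square misses the
horizontal edges, and meets the closed central strip only inside the model square. -/
theorem abs_snd_lt_one_of_mem_interior {z : Plane}
    (hz : z ∈ interior (Set.Iic (-1 : ℝ) ×ˢ (Set.univ : Set ℝ) ∪ modelSquare ∪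
      Set.Ici (1 : ℝ) ×ˢ (Set.univ : Set ℝ)))
    (hx : z.1 ∈ Set.Icc (-1 : ℝ) 1) : |z.2| < 1 := by
  -- If `|z.2| ≥ 1`, a small move of `z.1` towards the centre and of `z.2` away from it reaches a
  -- point with `|x| < 1 < |y|`, outside all three pieces. Moving `x` too handles the lines `x =
  -- ±1`, which belong to the half-planes.
  by_contra! hy
  obtain ⟨δ, hδ, hball⟩ := Metric.isOpen_iff.1 isOpen_interior z hz
  -- The bound `η < 1` keeps a step from one half of `[-1,1]` towards the other from overshooting.
  obtain ⟨η, hη, hηδ, hη1⟩ : ∃ η : ℝ, 0 < η ∧ η < δ ∧ η < 1 :=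
    ⟨min (δ / 2) (1 / 2), by positivity, (min_le_left _ _).trans_lt (by linarith),
      (min_le_right _ _).trans_lt (by norm_num)⟩
  obtain ⟨x, hxd, hx1, hx2⟩ : ∃ x : ℝ, |x - z.1| < δ ∧ -1 < x ∧ x < 1 := by
    rcases le_total z.1 0 with h | h
    · refine ⟨z.1 + η, ?_, ?_, ?_⟩
      · rwa [add_sub_cancel_left, abs_of_pos hη]
      · linarith [hx.1]
      · linarith
    · refine ⟨z.1 - η, ?_, ?_, ?_⟩
      · rwa [sub_sub_cancel_left, abs_neg, abs_of_pos hη]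
      · linarith
      · linarith [hx.2]
  obtain ⟨y, hyd, hy1⟩ : ∃ y : ℝ, |y - z.2| < δ ∧ 1 < |y| := by
    rcases le_total z.2 0 with h | h
    · rw [abs_of_nonpos h] at hy
      refine ⟨z.2 - η, ?_, ?_⟩
      · rwa [sub_sub_cancel_left, abs_neg, abs_of_pos hη]
      · rw [abs_of_neg (by linarith)]; linarith
    · rw [abs_of_nonneg h] at hy
      refine ⟨z.2 + η, ?_, ?_⟩
      · rwa [add_sub_cancel_left, abs_of_pos hη]
      · rw [abs_of_pos (by linarith)]; linarith
  have hmem : ((x, y) : Plane) ∈ Metric.ball z δ := by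
    rw [Metric.mem_ball, Prod.dist_eq, Real.dist_eq, Real.dist_eq]
    exact max_lt hxd hyd
  rcases interior_subset (hball hmem) with (h | h) | h
  · exact absurd h.1 (not_le.2 hx1)
  · exact absurd (abs_le.2 h.2) (not_le.2 hy1)
  · exact absurd h.1 (not_le.2 hx2)

namespace PlanarHSet

/-- A covering criterion in model coordinates: the homotopy first squeezes the image onto the
horizontal axis and then moves it along that axis to the model map `A`. -/
theorem coversWith_of_model {N M : PlanarHSet} {f : Plane → Plane} (hf : Continuous f)
    {A : ℝ → ℝ} (hA : Continuous A)
    (hentry : ∀ z ∈ modelSquare, (M.chart.symm (f (N.chart z))).1 ∈ Set.Icc (-1 : ℝ) 1 →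
      |(M.chart.symm (f (N.chart z))).2| < 1)
    (hexit : ∀ z ∈ modelExit,
      ((M.chart.symm (f (N.chart z))).1 < -1 ∧ A z.1 < -1) ∨
        (1 < (M.chart.symm (f (N.chart z))).1 ∧ 1 < A z.1)) :
    N.CoversWith M f (degreeOne A (-1) 1 0) := by
  set F : Plane → Plane := fun z => M.chart.symm (f (N.chart z)) with hF
  have hFc : Continuous F := M.chart.symm.continuous.comp (hf.comp N.chart.continuous)
  have hAend : ∀ p ∈ ({-1, 1} : Set ℝ), A p ∉ Set.Icc (-1 : ℝ) 1 := by
    rintro p hp ⟨h1, h2⟩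
    rcases hexit (p, 0) ⟨hp, by norm_num⟩ with h | h
    · exact absurd h.2 (not_lt.2 h1)
    · exact absurd h.2 (not_lt.2 h2)
  -- Up to `r = 1/2` only the second coordinate shrinks; afterwards it is zero and the first
  -- coordinate moves to `A`. Doing both at once could carry a point with large second coordinate
  -- across a horizontal edge.
  refine ⟨fun r z => ((1 - max 0 (2 * r - 1)) * (F z).1 + max 0 (2 * r - 1) * A z.1,
    max 0 (1 - 2 * r) * (F z).2), ?_, ?_, ?_, ?_, A, hA, ?_,
    hAend _ (by simp), hAend _ (by simp), rfl⟩
  · refine Continuous.continuousOn ?_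
    unfold Function.uncurry
    fun_prop
  · intro z _
    norm_num [hF]
  · rintro r ⟨hr0, hr1⟩ z hz ⟨⟨h1, h2⟩, -⟩
    simp only at h1 h2
    have hs0 : 0 ≤ max 0 (2 * r - 1) := le_max_left _ _
    have hs1 : max 0 (2 * r - 1) ≤ 1 := max_le zero_le_one (by linarith)
    generalize max 0 (2 * r - 1) = s at h1 h2 hs0 hs1
    -- Each open half-plane beyond the square is convex, so the segment between two of its points
    -- stays there.
    rcases hexit z hz with ⟨ha, hb⟩ | ⟨ha, hb⟩
    · exact absurd ((convex_Iio (-1 : ℝ)) ha hb (sub_nonneg.2 hs1) hs0 (sub_add_cancel 1 s))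
        (not_lt.2 h1)
    · exact absurd ((convex_Ioi (1 : ℝ)) ha hb (sub_nonneg.2 hs1) hs0 (sub_add_cancel 1 s))
        (not_lt.2 h2)
  · rintro r ⟨hr0, hr1⟩ z hz ⟨h1, h2⟩
    simp only at h1 h2
    have h2' : |max 0 (1 - 2 * r) * (F z).2| = 1 := by
      rcases h2 with h | h <;> rw [h] <;> norm_num
    rcases le_total r (1 / 2) with hr | hr
    -- The first coordinate is still that of `F z`, so `hentry` applies, and a factor `1 - 2 * r ≤
    -- 1` cannot bring `|(F z).2| < 1` up to `1`.
    · rw [max_eq_left (by linarith), sub_zero, one_mul, zero_mul, add_zero] at h1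
      have h3 : |(F z).2| < 1 := hentry z hz h1
      rw [abs_mul, max_eq_right (by linarith), abs_of_nonneg (by linarith)] at h2'
      nlinarith [abs_nonneg (F z).2]
    · rw [max_eq_left (by linarith), zero_mul, abs_zero] at h2'
      exact zero_ne_one h2'
  · intro z _
    norm_num

/-- The chart coordinates of a point interior to the image of a set are interior to that set. -/
theorem chart_symm_mem_interior {M : PlanarHSet} {s : Set Plane} {p : Plane}
    (hp : p ∈ interior (M.chart '' s)) : M.chart.symm p ∈ interior s := by
  rw [← M.chart.image_interior] at hp
  obtain ⟨z, hz, rfl⟩ := hp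
  rwa [M.chart.symm_apply_apply]

/-- If `f` maps the support of `N` into the interior of the union of the sides and the support of
`M`, then in model coordinates its image misses the horizontal edges and everything beyond them. -/
theorem abs_snd_lt_one_of_image_subset {N M : PlanarHSet} {f : Plane → Plane}
    (ha : f '' N.support ⊆ interior (M.leftSide ∪ M.support ∪ M.rightSide)) {z : Plane}
    (hz : z ∈ modelSquare) (hx : (M.chart.symm (f (N.chart z))).1 ∈ Set.Icc (-1 : ℝ) 1) :
    |(M.chart.symm (f (N.chart z))).2| < 1 := by
  have h := ha (Set.mem_image_of_mem f (Set.mem_image_of_mem N.chart hz))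
  rw [leftSide, support, rightSide, ← Set.image_union, ← Set.image_union] at h
  exact abs_snd_lt_one_of_mem_interior (chart_symm_mem_interior h) hx

/-- If `f` maps the support of `N` into the interior of the region of `M` consisting of its sides
and support, and the edges of `N` into the interiors of the corresponding sides of `M`, then `N`
`f`-covers `M` with degree `1`. -/
theorem coversWith_one {N M : PlanarHSet} {f : Plane → Plane} (hf : Continuous f)
    (ha : f '' N.support ⊆ interior (M.leftSide ∪ M.support ∪ M.rightSide))
    (hl : f '' N.leftEdge ⊆ interior M.leftSide)
    (hr : f '' N.rightEdge ⊆ interior M.rightSide) : N.CoversWith M f 1 := by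
  -- Any slope above `1` would do: the endpoints `±1` must leave `[-1,1]`.
  have hdeg : degreeOne (fun x => 2 * x) (-1) 1 0 = 1 := by
    norm_num [degreeOne, sign_pos, sign_neg]
  rw [← hdeg]
  refine coversWith_of_model hf (by fun_prop) (fun z => abs_snd_lt_one_of_image_subset ha) ?_
  rintro ⟨p, q⟩ ⟨rfl | rfl, hq⟩
  · exact Or.inl ⟨fst_lt_neg_one_of_mem_interior (chart_symm_mem_interior
      (hl (Set.mem_image_of_mem f (Set.mem_image_of_mem N.chart ⟨rfl, hq⟩)))), by norm_num⟩
  · exact Or.inr ⟨one_lt_fst_of_mem_interior (chart_symm_mem_interior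
      (hr (Set.mem_image_of_mem f (Set.mem_image_of_mem N.chart ⟨rfl, hq⟩)))), by norm_num⟩

/-- If `f` maps the support of `N` into the interior of the region of `M` consisting of its sides
and support, and the edges of `N` into the interiors of the opposite sides of `M`, then `N`
`f`-covers `M` with degree `-1`. -/
theorem coversWith_neg_one {N M : PlanarHSet} {f : Plane → Plane} (hf : Continuous f)
    (ha : f '' N.support ⊆ interior (M.leftSide ∪ M.support ∪ M.rightSide))
    (hl : f '' N.leftEdge ⊆ interior M.rightSide)
    (hr : f '' N.rightEdge ⊆ interior M.leftSide) : N.CoversWith M f (-1) := by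
  have hdeg : degreeOne (fun x => -2 * x) (-1) 1 0 = -1 := by
    norm_num [degreeOne, sign_pos, sign_neg]
  rw [← hdeg]
  refine coversWith_of_model hf (by fun_prop) (fun z => abs_snd_lt_one_of_image_subset ha) ?_
  rintro ⟨p, q⟩ ⟨rfl | rfl, hq⟩
  · exact Or.inr ⟨one_lt_fst_of_mem_interior (chart_symm_mem_interior
      (hl (Set.mem_image_of_mem f (Set.mem_image_of_mem N.chart ⟨rfl, hq⟩)))), by norm_num⟩
  · exact Or.inl ⟨fst_lt_neg_one_of_mem_interior (chart_symm_mem_interior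
      (hr (Set.mem_image_of_mem f (Set.mem_image_of_mem N.chart ⟨rfl, hq⟩)))), by norm_num⟩

end PlanarHSet

theorem mainTheorem4 (f : Plane → Plane) (hf : Continuous f) (N₁ N₂ : FuzzyHSet)
    (hinj : Set.InjOn f (FuzzyHSet.support N₁))
    (haf : f '' FuzzyHSet.support N₁ ⊆ FuzzyHSet.strip N₂)
    (hbf :
      (f '' FuzzyHSet.leftEdge N₁ ⊆ interior (FuzzyHSet.leftSide N₂) ∧
        f '' FuzzyHSet.rightEdge N₁ ⊆ interior (FuzzyHSet.rightSide N₂)) ∨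
      (f '' FuzzyHSet.leftEdge N₁ ⊆ interior (FuzzyHSet.rightSide N₂) ∧
        f '' FuzzyHSet.rightEdge N₁ ⊆ interior (FuzzyHSet.leftSide N₂))) :
    FuzzyHSet.Covers N₁ N₂ f := by
  have hleft : ∀ {M₁}, M₁ ∈ N₁ → f '' M₁.leftEdge ⊆ f '' FuzzyHSet.leftEdge N₁ := fun h =>
    Set.image_mono ((Set.subset_biUnion_of_mem h).trans (subset_convexHull ℝ _))
  have hright : ∀ {M₁}, M₁ ∈ N₁ → f '' M₁.rightEdge ⊆ f '' FuzzyHSet.rightEdge N₁ := fun h =>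
    Set.image_mono ((Set.subset_biUnion_of_mem h).trans (subset_convexHull ℝ _))
  have hstrip : ∀ {M₁ M₂}, M₁ ∈ N₁ → M₂ ∈ N₂ → f '' M₁.support ⊆
      interior (M₂.leftSide ∪ M₂.support ∪ M₂.rightSide) := fun h₁ h₂ =>
    ((Set.image_mono ((Set.subset_biUnion_of_mem h₁).trans (subset_convexHull ℝ _))).trans
      haf).trans (Set.biInter_subset_of_mem h₂)
  have hl₂ : ∀ {M₂}, M₂ ∈ N₂ → interior (FuzzyHSet.leftSide N₂) ⊆ interior M₂.leftSide :=
    fun h => interior_mono (Set.biInter_subset_of_mem h)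
  have hr₂ : ∀ {M₂}, M₂ ∈ N₂ → interior (FuzzyHSet.rightSide N₂) ⊆ interior M₂.rightSide :=
    fun h => interior_mono (Set.biInter_subset_of_mem h)
  -- The alternative concerns the whole fuzzy sets, so one degree serves all pairs of members.
  rcases hbf with ⟨hl, hr⟩ | ⟨hl, hr⟩
  · exact ⟨1, one_ne_zero, fun M₁ h₁ M₂ h₂ => PlanarHSet.coversWith_one hf (hstrip h₁ h₂)
      (((hleft h₁).trans hl).trans (hl₂ h₂)) (((hright h₁).trans hr).trans (hr₂ h₂))⟩
  · exact ⟨-1, by norm_num, fun M₁ h₁ M₂ h₂ => PlanarHSet.coversWith_neg_one hf (hstrip h₁ h₂)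
      (((hleft h₁).trans hl).trans (hr₂ h₂)) (((hright h₁).trans hr).trans (hl₂ h₂))⟩
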